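/- **Setting.** Let $N$ (students), $M$ (colleges) and $F$ (features) be finite sets. An instance consists of a capacity $x_c\ge 1$ and a strict total order $\succ_c$ on $N$ for each college $c\in M$, and, for each student $s\in N$, of utility functions $u_s^f:M\to[0,1]$ $(f\in F)$ and a probability distribution $\mu_s$ on the weight vectors $w\in\mathbb R^F$ with $w^f\ge 0$ and $\sum_f w^f=1$. For a weight vector $w$ write $c\succeq_s^w c'$ if $\sum_f w^fu_s^f(c)\ge\sum_f w^fu_s^f(c')$, and $c\succ_s^w c'$ if the inequality is strict; every college is strictly better for $s$ than being unmatched ($\mathsf{null}$). Below, $\Pr$ and $\mathbb E$ for student $s$ refer to $w_s\sim\mu_s$. **GDA.** Initially nobody is matched and $R_s=\emptyset$ for all $s$, where $R_s$ is the set of colleges that have rejected $s$. As long as some unmatched student $s$ has $R_s\ne M$, do the following round: every unmatched student $s$ with $R_s\ne M$ proposes to the college $\mathsf{Next}(s,R_s,(u_s^f)_f,\mu_s)\notin R_s$; then every college $c$ keeps, among the students it holds and those who just proposed to it, its $x_c$ most preferred ones (all of them if there are at most $x_c$), and rejects the others, who become unmatched and have $c$ added to their sets $R_s$. The final matching is the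 output. **Proposing rules.** For $R\subsetneq M$ and $c\notin R$ let $\tilde q_s(c,R)$ be the vector of the numbers $\Pr[c\succeq_s^{w_s}c']$, $c'\in M\setminus R$, $c'\neq c$, in ascending order. The college $\mathsf{Next}(s,R,(u_s^f)_f,\mu_s)$ is an element $c$ of $M\setminus R$ which, among all elements of $M\setminus R$, - HEUF: maximizes $\mathbb E[\sum_f w_s^fu_s^f(c)]$; - LOCV: has the lexicographically largest comparison vector $\tilde q_s(c,\emptyset)$; - LOICV: has the lexicographically largest comparison vector $\tilde q_s(c,R)$; - HERF: maximizes $\Pr[\,c\succeq_s^{w_s}c'\text{ for all }c'\in M\setminus R,\ c'\ne c\,]$; with any predetermined or random tie-breaking. **Theorem.** GDA with any of the proposing rules LOCV, LOICV, HERF, HEUF is incentive compatible with certainty (IC-C). That is, for every instance, every student $s$ and every misreport $(u_s',\mu_s')$ of her utility functions and distribution (all other data unchanged), if $\pi(s)$ and $\pi'(s)$ are her assignments (a college or $\mathsf{null}$) under her truthful report $(u_s,\mu_s)$ and under the misreport, then $$\Pr_{w_s\sim\mu_s}\bigl[\pi'(s)\succ_s^{w_s}\pi(s)\bigr]\neq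 1 .$$ With random tie-breaking (a random seed selects the tie-breaking, the seeds of the two runs of the algorithm being independent), the probability that $\pi'(s)\succ_s^{w_s}\pi(s)$, taken over both seeds and $w_s\sim\mu_s$, is not $1$ either. -/

import Mathlib

open MeasureTheory

namespace SchoolChoice

/-! School choice with feature-based uncertain preferences: `S` is the set of students, `C` the set
of colleges and `F` the set of features. -/

/-- What a student reports: a utility function `u f : C → [0,1]` for each feature `f`, and a
probability distribution `μ` on the weight vectors, i.e. on the `w : F → ℝ` with `0 ≤ w f` for
all `f` and `∑ f, w f = 1`. -/
structure Report (C F : Type*) [Fintype F] where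
  u : F → C → Set.Icc (0 : ℝ) 1
  μ : ProbabilityMeasure (stdSimplex ℝ F)

/-- An instance of the problem: positive capacities, strict preferences of the colleges over the
students (`pref c s s'` means that `c` prefers `s` to `s'`), and the students' information. -/
structure Instance (S C F : Type*) [Fintype F] where
  cap : C → ℕ
  cap_pos : ∀ c, 0 < cap c
  pref : C → S → S → Prop
  pref_strict : ∀ c, IsStrictTotalOrder S (pref c)
  report : S → Report C F

/-- The instance in which the information of student `s` is replaced by `r`. -/
def Instance.misreport {S C F : Type*} [DecidableEq S] [Fintype F]
    (I : Instance S C F) (s : S) (r : Report C F) : Instance S C F :=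
  { I with report := Function.update I.report s r }

section Reports

variable {C F : Type*} [Fintype C] [DecidableEq C] [Fintype F]

/-- The weighted utility `∑ f, w f * u f c` of college `c`. -/
def Report.util (r : Report C F) (w : stdSimplex ℝ F) (c : C) : ℝ :=
  ∑ f, w.1 f * (r.u f c : ℝ)

/-- The expected utility of `c`, for `w` distributed according to `r.μ`. -/
noncomputable def Report.expUtil (r : Report C F) (c : C) : ℝ :=
  ∫ w, r.util w c ∂(r.μ : Measure (stdSimplex ℝ F))

/-- `Pr[c ⪰ c']`, for `w` distributed according to `r.μ`. -/
noncomputable def Report.prGE (r : Report C F) (c c' : C) : ℝ :=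
  (r.μ : Measure (stdSimplex ℝ F)).real {w | r.util w c' ≤ r.util w c}

/-- The probability that `c` is weakly preferred to all other colleges outside `R`. -/
noncomputable def Report.prTop (r : Report C F) (R : Finset C) (c : C) : ℝ :=
  (r.μ : Measure (stdSimplex ℝ F)).real
    {w | ∀ c', c' ≠ c → c' ∉ R → r.util w c' ≤ r.util w c}

/-- The comparison vector of `c` relative to the colleges outside `R`: the numbers `Pr[c ⪰ c']`
with `c' ∉ R` and `c' ≠ c`, in ascending order. -/
noncomputable def Report.compVec (r : Report C F) (R : Finset C) (c : C) : List ℝ :=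
  (((Finset.univ \ R).erase c).val.map (fun c' => r.prGE c c')).sort (· ≤ ·)

/-- Lexicographic comparison: for some `k` the first `k` entries of `l` and `l'` agree, and the
next entry of `l` is larger than that of `l'`. -/
def LexGT (l l' : List ℝ) : Prop :=
  ∃ (k : ℕ) (h : k < l.length) (h' : k < l'.length), l.take k = l'.take k ∧ l'[k] < l[k]

/-- Strict preference of a student with information `r` over assignments, under the weight vector
`w`; `none` means that she is unmatched, which is worse than any college. -/
def Report.Prefers (r : Report C F) (w : stdSimplex ℝ F) : Option C → Option C → Prop
  | some c', some c => r.util w c < r.util w c'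
  | some _, none => True
  | none, _ => False

end Reports

section Rules

/-- A proposing rule `Next`: the college to which student `s` with information `r` proposes next
when `R` is the set of colleges that have rejected her (only used for `R` not the set of all
colleges). Tie-breaking is part of the rule. -/
abbrev Rule (S C F : Type*) [Fintype F] := S → Finset C → Report C F → C

variable {S C F : Type*} [Fintype C] [DecidableEq C] [Fintype F]

/-- Higher Expected Utility First. -/
def IsHEUF (next : Rule S C F) : Prop :=
  ∀ s R r, R ≠ Finset.univ → next s R r ∉ R ∧
    ∀ c, c ∉ R → r.expUtil c ≤ r.expUtil (next s R r)

/-- Lexicographic Order of Comparison Vectors: `Next` returns a college outside `R` that comes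
first in the lexicographic order of the comparison vectors among all colleges; ties are broken in
any way. -/
def IsLOCV (next : Rule S C F) : Prop :=
  ∀ s R r, R ≠ Finset.univ → next s R r ∉ R ∧
    ∀ c, c ∉ R → ¬ LexGT (r.compVec ∅ c) (r.compVec ∅ (next s R r))

/-- Lexicographic Order of Iterated Comparison Vectors: as before, with the comparison vectors
taken among the colleges outside `R`. -/
def IsLOICV (next : Rule S C F) : Prop :=
  ∀ s R r, R ≠ Finset.univ → next s R r ∉ R ∧
    ∀ c, c ∉ R → ¬ LexGT (r.compVec R c) (r.compVec R (next s R r))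

/-- Higher Expected Ranking First. -/
def IsHERF (next : Rule S C F) : Prop :=
  ∀ s R r, R ≠ Finset.univ → next s R r ∉ R ∧
    ∀ c, c ∉ R → r.prTop R c ≤ r.prTop R (next s R r)

end Rules

section GDA

variable {S C F : Type*} [Fintype S] [Fintype C] [DecidableEq C] [Fintype F]

/-- A state of the deferred acceptance algorithm: the current matching, and for each student the
set of colleges that have rejected her. -/
structure State (S C : Type*) where
  assigned : S → Option C
  rejected : S → Finset C

/-- The initial state: nobody is matched, nobody has been rejected. -/
def State.init (S C : Type*) : State S C := ⟨fun _ => none, fun _ => ∅⟩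

/-- The college for which `s` is a candidate in the current round: the one that holds her or, if
she is unmatched and not yet rejected by all colleges, the one to which she proposes. -/
def State.target (next : Rule S C F) (I : Instance S C F) (σ : State S C) (s : S) : Option C :=
  match σ.assigned s with
  | some c => some c
  | none => if σ.rejected s = Finset.univ then none
      else some (next s (σ.rejected s) (I.report s))

open Classical in
/-- One round: every unmatched student who has not been rejected by all colleges proposes, and then
every college `c` keeps its `cap c` most preferred candidates (all of them if there are at most
`cap c`), namely those to whom it prefers fewer than `cap c` candidates, and rejects the others. -/
noncomputable def State.step (next : Rule S C F) (I : Instance S C F) (σ : State S C) :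
    State S C where
  assigned s :=
    match σ.target next I s with
    | none => none
    | some c =>
      if (Finset.univ.filter fun s' => σ.target next I s' = some c ∧ I.pref c s' s).card < I.cap c
      then some c else none
  rejected s :=
    match σ.target next I s with
    | none => σ.rejected s
    | some c =>
      if (Finset.univ.filter fun s' => σ.target next I s' = some c ∧ I.pref c s' s).card < I.cap c
      then σ.rejected s else insert c (σ.rejected s)

/-- The final state of the generalized deferred acceptance algorithm. Once every unmatched student
has been rejected by all colleges, a round changes nothing; this happens after at most `|S| * |C|`
rounds, see `gdaState_final`. -/
noncomputable def gdaState (next : Rule S C F) (I : Instance S C F) : State S C :=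
  (State.step next I)^[Fintype.card S * Fintype.card C] (State.init S C)

/-- The generalized student-proposing deferred acceptance algorithm with proposing rule `next`;
it returns the matching, `none` meaning unmatched. -/
noncomputable def GDA (next : Rule S C F) (I : Instance S C F) : S → Option C :=
  (gdaState next I).assigned

/-- All colleges to which `s` has proposed so far. -/
def State.proposed (σ : State S C) (s : S) : Finset C :=
  σ.rejected s ∪ (σ.assigned s).toFinset

theorem State.proposed_step (next : Rule S C F) (I : Instance S C F) (σ : State S C)
    (s : S) : (σ.step next I).proposed s = σ.rejected s ∪ (σ.target next I s).toFinset := by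
  unfold State.proposed State.step
  simp only
  cases h : σ.target next I s with
  | none => simp
  | some c =>
    simp only
    split_ifs
    · rfl
    · ext x; simp

/-- The loop has ended: in the state returned, every unmatched student has been rejected by all
colleges. -/
theorem gdaState_final (next : Rule S C F)
    (hnext : ∀ s R r, R ≠ Finset.univ → next s R r ∉ R) (I : Instance S C F) (s : S)
    (hs : (gdaState next I).assigned s = none) :
    (gdaState next I).rejected s = Finset.univ := by
  classical
  have mono : ∀ (σ : State S C) (t : S), σ.proposed t ⊆ (σ.step next I).proposed t := by
    intro σ t
    rw [State.proposed_step]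
    unfold State.proposed State.target
    cases h : σ.assigned t <;> simp
  have grow : ∀ (σ : State S C) (t : S), σ.assigned t = none → σ.rejected t ≠ Finset.univ →
      (σ.proposed t).card < ((σ.step next I).proposed t).card := by
    intro σ t h1 h2
    apply Finset.card_lt_card
    refine (Finset.ssubset_iff_of_subset (mono σ t)).2 ⟨next t (σ.rejected t) (I.report t), ?_, ?_⟩
    · rw [State.proposed_step]
      simp [State.target, h1, h2]
    · simpa [State.proposed, h1] using hnext t _ _ h2
  have key : ∀ n : ℕ,
      (∀ t c, ((State.step next I)^[n] (State.init S C)).assigned t = some c →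
        (Finset.univ.filter fun t' =>
          ((State.step next I)^[n] (State.init S C)).assigned t' = some c ∧
            I.pref c t' t).card < I.cap c) ∧
      ((∀ t, ((State.step next I)^[n] (State.init S C)).assigned t = none →
          ((State.step next I)^[n] (State.init S C)).rejected t = Finset.univ) ∨
        n ≤ ∑ t, (((State.step next I)^[n] (State.init S C)).proposed t).card) := by
    intro n
    induction n with
    | zero => simp [State.init]
    | succ n ih =>
      rw [Function.iterate_succ_apply']
      generalize (State.step next I)^[n] (State.init S C) = σ at ih ⊢
      obtain ⟨hV, hD⟩ := ih
      have hsub : ∀ t c, (σ.step next I).assigned t = some c → σ.target next I t = some c ∧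
          (Finset.univ.filter fun t' => σ.target next I t' = some c ∧ I.pref c t' t).card
            < I.cap c := by
        intro t c h
        simp only [State.step] at h
        cases h' : σ.target next I t with
        | none => simp [h'] at h
        | some d =>
          rw [h'] at h
          simp only at h
          split_ifs at h with h2
          cases h
          exact ⟨rfl, h2⟩
      refine ⟨?_, ?_⟩
      · intro t c h
        refine lt_of_le_of_lt (Finset.card_le_card ?_) (hsub t c h).2
        intro x
        simp only [Finset.mem_filter, Finset.mem_univ, true_and]
        exact fun hx => ⟨(hsub x c hx.1).1, hx.2⟩
      · by_cases hdone : ∀ t, σ.assigned t = none → σ.rejected t = Finset.univ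
        · left
          have htar : ∀ t, σ.target next I t = σ.assigned t := by
            intro t
            unfold State.target
            cases h : σ.assigned t with
            | none => simp [hdone t h]
            | some c => rfl
          intro t h
          cases h' : σ.assigned t with
          | none =>
            simp only [State.step, htar, h']
            exact hdone t h'
          | some c =>
            exfalso
            simp only [State.step, htar, h'] at h
            rw [if_pos (hV t c h')] at h
            cases h
        · right
          have hle := hD.resolve_left hdone
          push Not at hdone
          obtain ⟨t, h1, h2⟩ := hdone
          have := Finset.sum_lt_sum (s := Finset.univ)
            (fun x _ => Finset.card_le_card (mono σ x)) ⟨t, Finset.mem_univ t, grow σ t h1 h2⟩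
          omega
  rcases (key (Fintype.card S * Fintype.card C)).2 with h | h
  · exact h s hs
  · by_contra hR
    have hlt : ((gdaState next I).proposed s).card < Fintype.card C := by
      rw [Finset.card_lt_iff_ne_univ]
      simpa [State.proposed, hs] using hR
    have := Finset.sum_lt_sum (s := Finset.univ)
      (f := fun t => ((gdaState next I).proposed t).card) (g := fun _ => Fintype.card C)
      (fun x _ => Finset.card_le_univ _) ⟨s, Finset.mem_univ s, hlt⟩
    simp only [Finset.sum_const, Finset.card_univ, smul_eq_mul] at this
    unfold gdaState at this
    omega

end GDA

section IncentiveCompatibility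

variable {S C F : Type*} [DecidableEq S] [Fintype F]

/-- Incentive compatibility with certainty of a matching algorithm: there are no instance, student
`s` and misreport `r` such that the assignment of `s` under the misreport is, with probability 1
according to her true information, strictly better than her assignment when she is truthful. -/
def ICC (alg : Instance S C F → S → Option C) : Prop :=
  ∀ (I : Instance S C F) (s : S) (r : Report C F),
    ((I.report s).μ : Measure (stdSimplex ℝ F))
      {w | (I.report s).Prefers w (alg (I.misreport s r) s) (alg I s)} ≠ 1

/-- Incentive compatibility with certainty of a randomized matching algorithm, with seed `t`
distributed according to `ν`: the runs of the algorithm on the truthful report and on the misreport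
use independent seeds, and the probability is over both seeds and the weight vector. -/
def ICCRandom {T : Type*} [MeasurableSpace T] (ν : Measure T)
    (alg : T → Instance S C F → S → Option C) : Prop :=
  ∀ (I : Instance S C F) (s : S) (r : Report C F),
    ((ν.prod ν).prod ((I.report s).μ : Measure (stdSimplex ℝ F)))
      {p | (I.report s).Prefers p.2 (alg p.1.2 (I.misreport s r) s) (alg p.1.1 I s)} ≠ 1

end IncentiveCompatibility

end SchoolChoice

/-! ### Lexicographic comparison of sorted lists -/

namespace SchoolChoice

/-! The result splits into a probabilistic half and a combinatorial half. The probabilistic half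
(`IsSafe`) says that none of the four rules proposes to a college while another available one is
almost surely strictly better. The almost surely better college has a larger mean, a
lexicographically larger comparison vector (`Report.lexGT_compVec`), and reduces the other's
probability of being top to zero, while some college has a positive one (`Report.exists_prTop_pos`).

The combinatorial half uses only that the next proposal depends on the report and the set of past
rejections. Each student then has a fixed proposal order (`proposalChain`), GDA is ordinary deferred
acceptance for these orders, and strategy-proofness (`notMem_rejected_of_gda`) keeps a misreport
from winning a college that rejected the student under truth-telling.

So a college `c'` won by misreporting was still available when the truthful match was proposed to,
and safety excludes that `c'` is better with certainty. If the truthful run leaves her unmatched,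
every college rejected her and no such `c'` exists. Random seeds reduce to a fixed one: only
finitely many behaviours of the rule matter, so one of them has positive probability, in both
independent runs at once. -/

theorem LexGT.cons {l l' : List ℝ} (a : ℝ) (h : LexGT l l') : LexGT (a :: l) (a :: l') := by
  obtain ⟨k, hk, hk', ht, hlt⟩ := h
  exact ⟨k + 1, by simpa using hk, by simpa using hk', by simpa using ht, by simpa using hlt⟩

/-- If the sorted list `l` has, for every threshold, at most as many entries below it as the sorted
list `l'` of the same length, and the lists differ, then `l` is lexicographically larger. -/
theorem lexGT_of_countP_le {l l' : List ℝ} (hl : l.Pairwise (· ≤ ·)) (hl' : l'.Pairwise (· ≤ ·))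
    (hlen : l.length = l'.length) (hne : l ≠ l')
    (hcount : ∀ v : ℝ, l.countP (· ≤ v) ≤ l'.countP (· ≤ v)) : LexGT l l' := by
  induction l generalizing l' with
  | nil => exact absurd (List.eq_nil_of_length_eq_zero hlen.symm).symm hne
  | cons a l ih =>
    cases l' with
    | nil => simp at hlen
    | cons b l' =>
      rcases lt_trichotomy a b with h | rfl | h
      -- At threshold `a` the right list has no entry and the left one has its head, against
      -- `hcount`.
      · have h1 : (b :: l').countP (· ≤ a) = 0 := by
          rw [List.countP_eq_zero]
          intro x hx
          have : b ≤ x := by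
            rcases List.mem_cons.1 hx with rfl | hx
            · exact le_rfl
            · exact List.rel_of_pairwise_cons hl' hx
          simpa using h.trans_le this
        have h2 := hcount a
        rw [h1] at h2
        simp at h2
      · refine LexGT.cons a (ih (List.Pairwise.of_cons hl) (List.Pairwise.of_cons hl')
          (by simpa using hlen) (by simpa using hne) fun v => ?_)
        have := hcount v
        simp only [List.countP_cons] at this
        omega
      · exact ⟨0, by simp, by simp, by simp, by simpa using h⟩

/-! ### Consequences of almost sure strict preference -/

section Reports

variable {C F : Type*} [Fintype F]

theorem Report.continuous_util (r : Report C F) (c : C) : Continuous fun w => r.util w c := by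
  unfold Report.util
  exact continuous_finsetSum _ fun f _ =>
    ((continuous_apply f).comp continuous_subtype_val).mul continuous_const

theorem Report.measurableSet_util_le (r : Report C F) (c c' : C) :
    MeasurableSet {w | r.util w c ≤ r.util w c'} :=
  measurableSet_le (r.continuous_util c).measurable (r.continuous_util c').measurable

theorem Report.measurableSet_prefers (r : Report C F) (a b : Option C) :
    MeasurableSet {w | r.Prefers w a b} := by
  cases a with
  | none => simp [Report.Prefers]
  | some a =>
    cases b with
    | none => simp [Report.Prefers]
    | some b =>
      exact measurableSet_lt (r.continuous_util b).measurable (r.continuous_util a).measurable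

theorem Report.integrable_util (r : Report C F) (c : C) :
    Integrable (fun w => r.util w c) (r.μ : Measure (stdSimplex ℝ F)) := by
  refine Integrable.of_bound (C := 1) (r.continuous_util c).aestronglyMeasurable
    (Filter.Eventually.of_forall fun w => ?_)
  have h0 : 0 ≤ r.util w c :=
    Finset.sum_nonneg fun f _ => mul_nonneg (w.2.1 f) (r.u f c).2.1
  -- The bound 1 is replaced by the sum of the weights, for a termwise comparison.
  rw [Real.norm_of_nonneg h0, ← w.2.2]
  exact Finset.sum_le_sum fun f _ => mul_le_of_le_one_right (w.2.1 f) (r.u f c).2.2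

theorem Report.ae_of_measure_eq_one (r : Report C F) {c c' : C}
    (h : (r.μ : Measure (stdSimplex ℝ F)) {w | r.Prefers w (some c') (some c)} = 1) :
    ∀ᵐ w ∂(r.μ : Measure (stdSimplex ℝ F)), r.util w c < r.util w c' :=
  (prob_compl_eq_zero_iff (r.measurableSet_prefers _ _)).2 h

theorem Report.expUtil_lt (r : Report C F) {c c' : C}
    (h : ∀ᵐ w ∂(r.μ : Measure (stdSimplex ℝ F)), r.util w c < r.util w c') :
    r.expUtil c < r.expUtil c' := by
  have h0 : 0 < ∫ w, (r.util w c' - r.util w c) ∂(r.μ : Measure (stdSimplex ℝ F)) := by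
    rw [integral_pos_iff_support_of_nonneg_ae]
    · have : (r.μ : Measure (stdSimplex ℝ F))
          (Function.support fun w => r.util w c' - r.util w c) = 1 := by
        rw [← prob_compl_eq_zero_iff
          (measurableSet_support (by
            exact ((r.continuous_util c').sub (r.continuous_util c)).measurable))]
        filter_upwards [h] with w hw
        simpa [Set.mem_compl_iff, Function.mem_support, sub_eq_zero] using hw.ne'
      rw [this]
      exact one_pos
    · filter_upwards [h] with w hw
      simpa using hw.le
    · exact (r.integrable_util c').sub (r.integrable_util c)
  rw [integral_sub (r.integrable_util c') (r.integrable_util c)] at h0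
  exact sub_pos.1 h0

theorem Report.prGE_eq_zero (r : Report C F) {c c' : C}
    (h : ∀ᵐ w ∂(r.μ : Measure (stdSimplex ℝ F)), r.util w c < r.util w c') :
    r.prGE c c' = 0 := by
  rw [Report.prGE, measureReal_eq_zero_iff, measure_eq_zero_iff_ae_notMem]
  filter_upwards [h] with w hw
  simpa using hw

theorem Report.prGE_eq_one (r : Report C F) {c c' : C}
    (h : ∀ᵐ w ∂(r.μ : Measure (stdSimplex ℝ F)), r.util w c < r.util w c') :
    r.prGE c' c = 1 := by
  have : (r.μ : Measure (stdSimplex ℝ F)) {w | r.util w c ≤ r.util w c'} = 1 := by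
    rw [← prob_compl_eq_zero_iff (r.measurableSet_util_le _ _)]
    filter_upwards [h] with w hw
    simpa using hw.le
  simp [Report.prGE, Measure.real, this]

theorem Report.prGE_mono (r : Report C F) {c c' : C} (d : C)
    (h : ∀ᵐ w ∂(r.μ : Measure (stdSimplex ℝ F)), r.util w c < r.util w c') :
    r.prGE c d ≤ r.prGE c' d := by
  refine ENNReal.toReal_mono (measure_ne_top _ _) (measure_mono_ae ?_)
  filter_upwards [h] with w hw hd
  exact le_trans hd hw.le

theorem Report.prTop_eq_zero (r : Report C F) {R : Finset C} {c c' : C} (hc' : c' ∉ R)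
    (h : ∀ᵐ w ∂(r.μ : Measure (stdSimplex ℝ F)), r.util w c < r.util w c') :
    r.prTop R c = 0 := by
  rw [Report.prTop, measureReal_eq_zero_iff, measure_eq_zero_iff_ae_notMem]
  filter_upwards [h] with w hw hmem
  exact absurd (hmem c' (by rintro rfl; exact lt_irrefl _ hw) hc') (not_le.2 hw)

variable [Fintype C] [DecidableEq C]

/-- Over the colleges `D` other than `c` and `c'`, each entry for `c'` is at least the corresponding
one for `c`. The one remaining entry is 1 for `c'` and 0 for `c`. Hence the vector of `c'` has no
more entries below any threshold, which `lexGT_of_countP_le` turns into lexicographic order after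
sorting. -/
theorem Report.lexGT_compVec (r : Report C F) {R : Finset C} {c c' : C} (hc : c ∉ R)
    (hc' : c' ∉ R)
    (h : ∀ᵐ w ∂(r.μ : Measure (stdSimplex ℝ F)), r.util w c < r.util w c') :
    LexGT (r.compVec R c') (r.compVec R c) := by
  have hne : c ≠ c' := by
    rintro rfl
    obtain ⟨w, hw⟩ := h.exists
    exact lt_irrefl _ hw
  have hdecomp : ∀ a b : C, a ∉ R → b ≠ a →
      ((Finset.univ \ R).erase b).val = a ::ₘ (((Finset.univ \ R).erase a).erase b).val := by
    intro a b ha hab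
    rw [← Finset.insert_val_of_notMem (by simp), Finset.erase_right_comm,
      Finset.insert_erase (by simp [ha, hab.symm])]
  set D := ((Finset.univ \ R).erase c).erase c' with hD
  have e1 := hdecomp c c' hc hne.symm
  have e2 := hdecomp c' c hc' hne
  rw [Finset.erase_right_comm, ← hD] at e2
  rw [← hD] at e1
  have hcount : ∀ (b : C) (v : ℝ), (r.compVec R b).countP (· ≤ v) =
      (((Finset.univ \ R).erase b).val.map fun d => r.prGE b d).countP (· ≤ v) := by
    intro b v
    rw [← Multiset.coe_countP, Report.compVec, Multiset.sort_eq]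
  have hD_le : ∀ v : ℝ, (D.val.map fun d => r.prGE c' d).countP (· ≤ v) ≤
      (D.val.map fun d => r.prGE c d).countP (· ≤ v) := by
    intro v
    rw [Multiset.countP_map, Multiset.countP_map]
    exact Multiset.card_le_card (Multiset.monotone_filter_right _ fun d hd =>
      (r.prGE_mono d h).trans hd)
  refine lexGT_of_countP_le (Multiset.pairwise_sort _ _) (Multiset.pairwise_sort _ _) ?_ ?_ ?_
  · rw [Report.compVec, Report.compVec, Multiset.length_sort, Multiset.length_sort, e1, e2]
    simp only [Multiset.map_cons, Multiset.card_cons, Multiset.card_map]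
  · intro heq
    -- Threshold 0 separates the vectors: the entry 0 is counted, the entry 1 is not.
    have := congrArg (List.countP (· ≤ (0 : ℝ))) heq
    rw [hcount, hcount, e1, e2, Multiset.map_cons, Multiset.map_cons, Multiset.countP_cons,
      Multiset.countP_cons, r.prGE_eq_zero h, r.prGE_eq_one h] at this
    have h' := hD_le 0
    simp only [le_refl, if_true, not_le.2 (zero_lt_one' ℝ), if_false] at this
    omega
  · intro v
    rw [hcount, hcount, e1, e2, Multiset.map_cons, Multiset.map_cons, Multiset.countP_cons,
      Multiset.countP_cons, r.prGE_eq_zero h, r.prGE_eq_one h]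
    refine add_le_add (hD_le v) ?_
    split_ifs with h1 h2
    · exact le_rfl
    · exact absurd (zero_le_one.trans h1) h2
    · exact zero_le_one
    · exact le_rfl

/-- Every weight vector has a best available college, so these finitely many events cover the whole
space and cannot all be null. -/
theorem Report.exists_prTop_pos (r : Report C F) {R : Finset C} (hR : R ≠ Finset.univ) :
    ∃ c, c ∉ R ∧ 0 < r.prTop R c := by
  by_contra! hcon
  have hnull : ∀ c, c ∉ R → (r.μ : Measure (stdSimplex ℝ F))
      {w | ∀ c', c' ≠ c → c' ∉ R → r.util w c' ≤ r.util w c} = 0 := fun c hc =>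
    (measureReal_eq_zero_iff (measure_ne_top _ _)).1
      (le_antisymm (hcon c hc) measureReal_nonneg)
  have hall : ∀ᵐ w ∂(r.μ : Measure (stdSimplex ℝ F)), ∀ c, c ∉ R →
      ¬ ∀ c', c' ≠ c → c' ∉ R → r.util w c' ≤ r.util w c := by
    rw [ae_all_iff]
    intro c
    by_cases hc : c ∈ R
    · simp [hc]
    · have := measure_eq_zero_iff_ae_notMem.1 (hnull c hc)
      filter_upwards [this] with w hw _
      exact hw
  obtain ⟨w, hw⟩ := hall.exists
  have hne : (Finset.univ \ R).Nonempty := by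
    rw [Finset.sdiff_nonempty]
    exact fun h => hR (Finset.univ_subset_iff.1 h)
  obtain ⟨c, hc, hmax⟩ := Finset.exists_max_image (Finset.univ \ R) (r.util w) hne
  exact hw c (by simpa using hc) fun c' _ hc' => hmax c' (by simpa using hc')

end Reports

/-! ### Safety of the four rules -/

section Rules

variable {S C F : Type*} [Fintype C] [DecidableEq C] [Fintype F]

/-- A rule is safe if it proposes to a college that has not rejected the student, and to which no
other such college is preferred with certainty. -/
def IsSafe (next : Rule S C F) : Prop :=
  ∀ s R r, R ≠ Finset.univ → next s R r ∉ R ∧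
    ∀ c, c ∉ R → (r.μ : Measure (stdSimplex ℝ F))
      {w | r.Prefers w (some c) (some (next s R r))} ≠ 1

theorem IsLOCV.isSafe {next : Rule S C F} (h : IsLOCV next) : IsSafe next := fun s R r hR =>
  ⟨(h s R r hR).1, fun c hc h1 => (h s R r hR).2 c hc
    (r.lexGT_compVec (Finset.notMem_empty _) (Finset.notMem_empty _)
      (r.ae_of_measure_eq_one h1))⟩

theorem IsLOICV.isSafe {next : Rule S C F} (h : IsLOICV next) : IsSafe next := fun s R r hR =>
  ⟨(h s R r hR).1, fun c hc h1 => (h s R r hR).2 c hc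
    (r.lexGT_compVec (h s R r hR).1 hc (r.ae_of_measure_eq_one h1))⟩

theorem IsHERF.isSafe {next : Rule S C F} (h : IsHERF next) : IsSafe next := fun s R r hR => by
  refine ⟨(h s R r hR).1, fun c hc h1 => ?_⟩
  obtain ⟨d, hd, hpos⟩ := r.exists_prTop_pos hR
  have := (h s R r hR).2 d hd
  rw [r.prTop_eq_zero hc (r.ae_of_measure_eq_one h1)] at this
  exact this.not_gt hpos

omit [DecidableEq C] in
theorem IsHEUF.isSafe {next : Rule S C F} (h : IsHEUF next) : IsSafe next := fun s R r hR =>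
  ⟨(h s R r hR).1, fun c hc h1 =>
    ((h s R r hR).2 c hc).not_gt (r.expUtil_lt (r.ae_of_measure_eq_one h1))⟩

end Rules

end SchoolChoice

namespace SchoolChoice

/-! ### The proposal order of a single student -/

section Chain

variable {C : Type*} [DecidableEq C]

/-- The set of the first `k` colleges proposed to by a student who proposes to `f R` after
having been rejected by `R`. -/
def proposalChain (f : Finset C → C) (k : ℕ) : Finset C :=
  (fun R => insert (f R) R)^[k] ∅

theorem proposalChain_succ (f : Finset C → C) (k : ℕ) :
    proposalChain f (k + 1) = insert (f (proposalChain f k)) (proposalChain f k) :=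
  Function.iterate_succ_apply' _ _ _

theorem proposalChain_mono (f : Finset C → C) : Monotone (proposalChain f) :=
  monotone_nat_of_le_succ fun k => by
    rw [proposalChain_succ]
    exact Finset.subset_insert _ _

theorem apply_proposalChain_mem (f : Finset C → C) {j k : ℕ} (h : j < k) :
    f (proposalChain f j) ∈ proposalChain f k :=
  proposalChain_mono f h (by rw [proposalChain_succ]; exact Finset.mem_insert_self _ _)

end Chain

/-! ### Invariants of deferred acceptance -/

section Run

variable {S C F : Type*} [Fintype S] [Fintype C] [DecidableEq C] [Fintype F]

open Classical in
/-- The invariants of a run of deferred acceptance. -/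
structure State.Valid (next : Rule S C F) (I : Instance S C F) (σ : State S C) : Prop where
  chain : ∀ t, ∃ k, σ.rejected t = proposalChain (fun R => next t R (I.report t)) k
  eq_next : ∀ t c, σ.assigned t = some c → c = next t (σ.rejected t) (I.report t)
  ne_univ : ∀ t c, σ.assigned t = some c → σ.rejected t ≠ Finset.univ
  notMem : ∀ t c, σ.assigned t = some c → c ∉ σ.rejected t
  feasible : ∀ c, (Finset.univ.filter fun x => σ.assigned x = some c).card ≤ I.cap c
  full : ∀ t c, c ∈ σ.rejected t →
    I.cap c ≤ (Finset.univ.filter fun x => σ.assigned x = some c ∧ I.pref c x t).card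

open Classical in
theorem State.step_assigned_eq_some {next : Rule S C F} {I : Instance S C F} {σ : State S C}
    {t : S} {c : C} : (σ.step next I).assigned t = some c ↔ σ.target next I t = some c ∧
      (Finset.univ.filter fun x => σ.target next I x = some c ∧ I.pref c x t).card < I.cap c := by
  simp only [State.step]
  cases h : σ.target next I t with
  | none => simp
  | some d =>
    simp only
    split_ifs with h1
    · constructor
      · intro h2
        cases h2
        exact ⟨rfl, h1⟩
      · exact fun h2 => h2.1
    · simp only [false_iff, not_and]
      intro h2
      cases h2
      exact h1

open Classical in
theorem State.mem_step_rejected {next : Rule S C F} {I : Instance S C F} {σ : State S C}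
    {t : S} {c : C} : c ∈ (σ.step next I).rejected t ↔ c ∈ σ.rejected t ∨
      σ.target next I t = some c ∧ I.cap c ≤
        (Finset.univ.filter fun x => σ.target next I x = some c ∧ I.pref c x t).card := by
  simp only [State.step]
  cases h : σ.target next I t with
  | none => simp
  | some d =>
    simp only
    split_ifs with h1
    · constructor
      · exact Or.inl
      · rintro (h2 | ⟨h2, h3⟩)
        · exact h2
        · cases h2
          exact absurd h1 (not_lt.2 h3)
    · rw [Finset.mem_insert, or_comm]
      refine or_congr_right ⟨?_, ?_⟩
      · rintro rfl
        exact ⟨rfl, not_lt.1 h1⟩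
      · rintro ⟨h2, -⟩
        cases h2
        rfl

omit [Fintype S] in
theorem State.target_eq_of_assigned {next : Rule S C F} {I : Instance S C F} {σ : State S C}
    {t : S} {c : C} (h : σ.assigned t = some c) : σ.target next I t = some c := by
  simp [State.target, h]

theorem State.rejected_subset_step (next : Rule S C F) (I : Instance S C F) (σ : State S C)
    (t : S) : σ.rejected t ⊆ (σ.step next I).rejected t :=
  fun _ hc => State.mem_step_rejected.2 (Or.inl hc)

/-- A candidate is either kept or rejected. -/
theorem State.mem_step_rejected_of_target {next : Rule S C F} {I : Instance S C F}
    {σ : State S C} {t : S} {c : C} (h : σ.target next I t = some c)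
    (h' : (σ.step next I).assigned t ≠ some c) : c ∈ (σ.step next I).rejected t := by
  classical
  refine State.mem_step_rejected.2 (Or.inr ⟨h, ?_⟩)
  by_contra h1
  exact h' (State.step_assigned_eq_some.2 ⟨h, not_le.1 h1⟩)

/-- A student who is kept has not been rejected in this round. -/
theorem State.step_rejected_of_assigned {next : Rule S C F} {I : Instance S C F}
    {σ : State S C} {t : S} {c : C} (h : (σ.step next I).assigned t = some c) :
    (σ.step next I).rejected t = σ.rejected t := by
  classical
  obtain ⟨h1, h2⟩ := State.step_assigned_eq_some.1 h
  ext d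
  rw [State.mem_step_rejected]
  refine or_iff_left ?_
  rintro ⟨h3, h4⟩
  rw [h1] at h3
  cases h3
  exact absurd h2 (not_lt.2 h4)

omit [Fintype S] in
open Classical in
/-- Among the members of `A`, those to whom fewer than `k` members are preferred are at most `k`;
and if `k` members are preferred to `t`, then `k` members with this property are. -/
theorem card_topmost (p : S → S → Prop) [IsStrictTotalOrder S p] (A : Finset S) (k : ℕ) :
    (A.filter fun x => (A.filter fun y => p y x).card < k).card ≤ k ∧
      ∀ t, k ≤ (A.filter fun y => p y t).card →
        k ≤ ((A.filter fun x => (A.filter fun y => p y x).card < k).filter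
          fun x => p x t).card := by
  set rank : S → ℕ := fun x => (A.filter fun y => p y x).card with hrank
  -- The weak version needs no membership in `A`; it will be applied to `t`, which may lie outside
  -- `A`.
  have hmono : ∀ x y, p x y → rank x ≤ rank y := fun x y hxy =>
    Finset.card_le_card (Finset.monotone_filter_right _ fun z _ hz => _root_.trans hz hxy)
  have hlt : ∀ x ∈ A, ∀ y, p x y → rank x < rank y := fun x hx y hxy => by
    refine Finset.card_lt_card ((Finset.ssubset_iff_of_subset
      (Finset.monotone_filter_right _ fun z _ hz => _root_.trans hz hxy)).2 ⟨x, ?_, ?_⟩)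
    · simp [hx, hxy]
    · simp [irrefl_of p x]
  have hinj : Set.InjOn rank A := by
    intro x hx y hy hxy
    rcases trichotomous_of p x y with h | h | h
    · exact absurd hxy (hlt x hx y h).ne
    · exact h
    · exact absurd hxy (hlt y hy x h).ne'
  have hinj' : Set.InjOn rank (A.filter fun x => rank x < k) :=
    hinj.mono (Finset.coe_subset.2 (Finset.filter_subset _ _))
  refine ⟨?_, fun t ht => ?_⟩
  · refine (Finset.card_image_of_injOn hinj').symm.trans_le
      ((Finset.card_le_card fun n hn => ?_).trans_eq (Finset.card_range k))
    obtain ⟨x, hx, rfl⟩ := Finset.mem_image.1 hn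
    exact Finset.mem_range.2 (Finset.mem_filter.1 hx).2
  -- The rank is injective on `A` with values below `A.card`, so it attains every such value, in
  -- particular all those below `k`.
  · have himage : A.image rank = Finset.range A.card := by
      refine Finset.eq_of_subset_of_card_le (fun n hn => ?_) ?_
      · obtain ⟨x, hx, rfl⟩ := Finset.mem_image.1 hn
        refine Finset.mem_range.2 (Finset.card_lt_card
          ((Finset.ssubset_iff_of_subset (Finset.filter_subset _ _)).2 ⟨x, hx, ?_⟩))
        simp [irrefl_of p x]
      · rw [Finset.card_image_of_injOn hinj, Finset.card_range]
    have hkA : k ≤ A.card := ht.trans (Finset.card_le_card (Finset.filter_subset _ _))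
    rw [Finset.filter_true_of_mem]
    · refine (Finset.card_range k).symm.trans_le
        ((Finset.card_le_card fun n hn => ?_).trans_eq (Finset.card_image_of_injOn hinj'))
      have hn' := Finset.mem_range.1 hn
      have : n ∈ A.image rank := by
        rw [himage]
        exact Finset.mem_range.2 (hn'.trans_le hkA)
      obtain ⟨x, hx, rfl⟩ := Finset.mem_image.1 this
      exact Finset.mem_image_of_mem _ (Finset.mem_filter.2 ⟨hx, by simpa using hn'⟩)
    · intro x hx
      have hxk := (Finset.mem_filter.1 hx).2
      rcases trichotomous_of p x t with h | rfl | h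
      · exact h
      · exact absurd hxk (not_lt.2 ht)
      · exact absurd hxk (not_lt.2 (ht.trans (hmono t x h)))

theorem State.valid_init (next : Rule S C F) (I : Instance S C F) :
    (State.init S C).Valid next I where
  chain _ := ⟨0, rfl⟩
  eq_next _ _ h := by simp [State.init] at h
  ne_univ _ _ h := by simp [State.init] at h
  notMem _ _ h := by simp [State.init] at h
  feasible _ := by simp [State.init]
  full _ _ h := by simp [State.init] at h

/-- A round either leaves a student's rejection set alone or adds her current target, which is the
next element of her chain. `feasible` and `full` are the two halves of `card_topmost`, applied to
the candidates of a college. -/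
theorem State.Valid.step {next : Rule S C F}
    (hnext : ∀ s R r, R ≠ Finset.univ → next s R r ∉ R) {I : Instance S C F} {σ : State S C}
    (h : σ.Valid next I) : (σ.step next I).Valid next I := by
  classical
  have htarget : ∀ t c, σ.target next I t = some c →
      σ.rejected t ≠ Finset.univ ∧ c = next t (σ.rejected t) (I.report t) := by
    intro t c hc
    unfold State.target at hc
    cases h1 : σ.assigned t with
    | some d =>
      rw [h1] at hc
      cases hc
      exact ⟨h.ne_univ t c h1, h.eq_next t c h1⟩
    | none =>
      rw [h1] at hc
      simp only at hc
      split_ifs at hc with h2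
      cases hc
      exact ⟨h2, rfl⟩
  have hcand : ∀ c, (Finset.univ.filter fun x => (σ.step next I).assigned x = some c) =
      (Finset.univ.filter fun x => σ.target next I x = some c).filter fun x =>
        ((Finset.univ.filter fun x => σ.target next I x = some c).filter
          fun y => I.pref c y x).card < I.cap c := by
    intro c
    ext x
    simp only [Finset.mem_filter, Finset.mem_univ, true_and, State.step_assigned_eq_some,
      Finset.filter_filter]
  have htop := fun c => haveI := I.pref_strict c
    card_topmost (I.pref c) (Finset.univ.filter fun x => σ.target next I x = some c) (I.cap c)
  refine ⟨fun t => ?_, fun t c hc => ?_, fun t c hc => ?_, fun t c hc => ?_, fun c => ?_,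
    fun t c hc => ?_⟩
  · obtain ⟨k, hk⟩ := h.chain t
    cases h1 : σ.target next I t with
    | none => exact ⟨k, by simp only [State.step, h1]; exact hk⟩
    | some c =>
      by_cases h2 : (σ.step next I).assigned t = some c
      · exact ⟨k, by rw [State.step_rejected_of_assigned h2, hk]⟩
      · refine ⟨k + 1, ?_⟩
        have h3 := State.mem_step_rejected_of_target h1 h2
        rw [proposalChain_succ, ← hk, ← (htarget t c h1).2]
        ext d
        rw [Finset.mem_insert, or_comm]
        constructor
        · intro hd
          rcases State.mem_step_rejected.1 hd with hd | ⟨hd, -⟩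
          · exact Or.inl hd
          · rw [h1] at hd
            cases hd
            exact Or.inr rfl
        · rintro (hd | rfl)
          · exact State.rejected_subset_step next I σ t hd
          · exact h3
  · rw [State.step_rejected_of_assigned hc]
    exact (htarget t c (State.step_assigned_eq_some.1 hc).1).2
  · rw [State.step_rejected_of_assigned hc]
    exact (htarget t c (State.step_assigned_eq_some.1 hc).1).1
  · rw [State.step_rejected_of_assigned hc]
    obtain ⟨h1, h2⟩ := htarget t c (State.step_assigned_eq_some.1 hc).1
    rw [h2]
    exact hnext _ _ _ h1
  · rw [hcand]
    exact (htop c).1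
  · rw [← Finset.filter_filter, hcand]
    refine (htop c).2 t ?_
    rw [Finset.filter_filter]
    rcases State.mem_step_rejected.1 hc with hc | hc
    -- For an older rejection, the students who filled the college are still candidates in this
    -- round.
    · refine (h.full t c hc).trans (Finset.card_le_card ?_)
      exact Finset.monotone_filter_right _ fun x _ hx =>
        ⟨State.target_eq_of_assigned hx.1, hx.2⟩
    · exact hc.2

/-- The state after `n` rounds. -/
noncomputable def runState (next : Rule S C F) (I : Instance S C F) (n : ℕ) : State S C :=
  (State.step next I)^[n] (State.init S C)

theorem runState_succ (next : Rule S C F) (I : Instance S C F) (n : ℕ) :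
    runState next I (n + 1) = (runState next I n).step next I :=
  Function.iterate_succ_apply' _ _ _

theorem runState_valid {next : Rule S C F}
    (hnext : ∀ s R r, R ≠ Finset.univ → next s R r ∉ R) (I : Instance S C F) (n : ℕ) :
    (runState next I n).Valid next I := by
  induction n with
  | zero => exact State.valid_init next I
  | succ n ih =>
    rw [runState_succ]
    exact ih.step hnext

theorem runState_rejected_mono (next : Rule S C F) (I : Instance S C F) (t : S) :
    Monotone fun n => (runState next I n).rejected t :=
  monotone_nat_of_le_succ fun n => by
    simp only [runState_succ]
    exact State.rejected_subset_step next I _ t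

/-- Two valid states that assign the same college to a student agree on who has rejected her. -/
theorem State.Valid.rejected_eq {next : Rule S C F} {I : Instance S C F} {σ τ : State S C}
    (hσ : σ.Valid next I) (hτ : τ.Valid next I) {t : S} {c : C}
    (h1 : σ.assigned t = some c) (h2 : τ.assigned t = some c) :
    σ.rejected t = τ.rejected t := by
  obtain ⟨j, hj⟩ := hσ.chain t
  obtain ⟨k, hk⟩ := hτ.chain t
  have e1 := hσ.eq_next t c h1
  have e2 := hτ.eq_next t c h2
  have n1 := hσ.notMem t c h1
  have n2 := hτ.notMem t c h2
  rw [hj] at e1 n1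
  rw [hk] at e2 n2
  rcases lt_trichotomy j k with hjk | rfl | hjk
  · exact absurd (apply_proposalChain_mem _ hjk) (e1 ▸ n2)
  · rw [hj, hk]
  · exact absurd (apply_proposalChain_mem _ hjk) (e2 ▸ n1)

/-- Suppose that `x` has the same information in two instances, that she has proposed to `d` in a
run on the first one, that in the final state `τ` of a run on the second one she is not matched to
`d`, and that her match there (if any) has not rejected her in the first run. Then `d` has
rejected her in the second run. -/
theorem State.Valid.mem_rejected {next : Rule S C F} {I J : Instance S C F} {σ τ : State S C}
    (hσ : σ.Valid next I) (hτ : τ.Valid next J) {x : S} {d : C}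
    (hrep : J.report x = I.report x)
    (hfinal : τ.assigned x = none → τ.rejected x = Finset.univ)
    (hd : d ∈ σ.proposed x) (hne : τ.assigned x ≠ some d)
    (hx : ∀ e, τ.assigned x = some e → e ∉ σ.rejected x) : d ∈ τ.rejected x := by
  cases he : τ.assigned x with
  | none => simp [hfinal he]
  | some e =>
    obtain ⟨j, hj⟩ := hσ.chain x
    obtain ⟨k, hk⟩ := hτ.chain x
    have e2 := hτ.eq_next x e he
    rw [hrep] at hk e2
    have hx' := hx e he
    rw [hj] at hx'
    rw [hk] at e2 ⊢
    -- The match `e` is the proposal at position `k` and is not among the first `j` proposals.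
    have hjk : j ≤ k := by
      by_contra hlt
      exact hx' (e2 ▸ apply_proposalChain_mem _ (not_le.1 hlt))
    rw [State.proposed, Finset.mem_union] at hd
    rcases hd with hd | hd
    · rw [hj] at hd
      exact proposalChain_mono _ hjk hd
    · have hd' : σ.assigned x = some d := by simpa [Option.mem_def] using hd
      have e1 := hσ.eq_next x d hd'
      rw [hj] at e1
      rcases hjk.lt_or_eq with hlt | rfl
      · rw [e1]
        exact apply_proposalChain_mem _ hlt
      · exact absurd (by rw [he, e1, e2]) hne

end Run

end SchoolChoice

namespace SchoolChoice

/-! ### Strategy-proofness of deferred acceptance -/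

section StrategyProof

variable {S C F : Type*} [Fintype S] [Fintype C] [DecidableEq C] [Fintype F]

theorem gdaState_valid {next : Rule S C F}
    (hnext : ∀ s R r, R ≠ Finset.univ → next s R r ∉ R) (I : Instance S C F) :
    (gdaState next I).Valid next I :=
  runState_valid hnext I _

/-- Strategy-proofness of deferred acceptance with respect to the order in which the students
propose: if two instances differ only in the information of student `s`, then `s` is not matched in
the second one to a college that has rejected her in the first one. -/
theorem notMem_rejected_of_gda {next : Rule S C F}
    (hnext : ∀ s R r, R ≠ Finset.univ → next s R r ∉ R) {I J : Instance S C F} {s : S}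
    (hcap : J.cap = I.cap) (hpref : J.pref = I.pref)
    (hrep : ∀ x, x ≠ s → J.report x = I.report x) {c : C} (hc : GDA next J s = some c) :
    c ∉ (gdaState next I).rejected s := by
  classical
  intro hcR
  have hσ := gdaState_valid hnext I
  have hτ := gdaState_valid hnext J
  have hτfinal := gdaState_final next hnext J
  have hσfinal := gdaState_final next hnext I
  rw [GDA] at hc
  set σ := gdaState next I with hσdef
  set τ := gdaState next J with hτdef
  -- `W` collects the students who gain in the second run, as measured by the rejections of the
  -- first. The aim is a contradiction from `s ∈ W`.
  set W : Finset S := Finset.univ.filter fun t => ∃ d, τ.assigned t = some d ∧ d ∈ σ.rejected t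
    with hW
  have memW : ∀ {t}, t ∈ W ↔ ∃ d, τ.assigned t = some d ∧ d ∈ σ.rejected t := by
    simp [hW]
  have hsW : s ∈ W := memW.2 ⟨c, hc, hcR⟩
  -- a student outside `W` who proposed to `d` in the first run, where `d` prefers her to one of
  -- its students in the second run, is matched to `d` in the second run
  have noblock : ∀ {x t : S} {d : C}, x ∉ W → d ∈ σ.proposed x → τ.assigned t = some d →
      I.pref d x t → τ.assigned x = some d := by
    intro x t d hxW hd ht hp
    by_contra hne
    have hxs : x ≠ s := fun h => hxW (h ▸ hsW)
    have hdR : d ∈ τ.rejected x := hσ.mem_rejected hτ (hrep x hxs) (hτfinal x) hd hne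
      fun e he heR => hxW (memW.2 ⟨e, he, heR⟩)
    have h1 := hτ.full x d hdR
    have h2 := hτ.feasible d
    have hlt : (Finset.univ.filter fun y => τ.assigned y = some d ∧ J.pref d y x).card <
        (Finset.univ.filter fun y => τ.assigned y = some d).card := by
      refine Finset.card_lt_card ((Finset.ssubset_iff_of_subset
        (Finset.monotone_filter_right _ fun y _ hy => hy.1)).2 ⟨t, by simpa using ht, ?_⟩)
      have := I.pref_strict d
      rw [hpref]
      simpa [ht] using asymm_of (I.pref d) hp
    omega
  -- A college that rejected `t` holds at least `cap` students preferred to `t` and at most `cap` in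
  -- all, so every student it holds is preferred.
  have hσpref : ∀ {t x : S} {d : C}, d ∈ σ.rejected t → σ.assigned x = some d →
      I.pref d x t := by
    intro t x d hd hx
    have h1 : (Finset.univ.filter fun y => σ.assigned y = some d ∧ I.pref d y t) =
        Finset.univ.filter fun y => σ.assigned y = some d :=
      Finset.eq_of_subset_of_card_le (Finset.monotone_filter_right _ fun y _ hy => hy.1)
        ((hσ.feasible d).trans (hσ.full t d hd))
    have h2 : x ∈ Finset.univ.filter fun y => σ.assigned y = some d := by simpa using hx
    rw [← h1] at h2
    exact (Finset.mem_filter.1 h2).2.2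
  have hcount : ∀ d, (W.filter fun x => τ.assigned x = some d).card ≤
      (W.filter fun x => σ.assigned x = some d).card := by
    intro d
    rcases (W.filter fun x => τ.assigned x = some d).eq_empty_or_nonempty with h | ⟨t, ht⟩
    · simp [h]
    obtain ⟨htW, htd⟩ := Finset.mem_filter.1 ht
    have hdR : d ∈ σ.rejected t := by
      obtain ⟨e, he, heR⟩ := memW.1 htW
      rw [htd] at he
      cases he
      exact heR
    have h1 : (Finset.univ.filter fun x => τ.assigned x = some d).card ≤
        (Finset.univ.filter fun x => σ.assigned x = some d).card :=
      calc _ ≤ J.cap d := hτ.feasible d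
        _ = I.cap d := by rw [hcap]
        _ ≤ _ := hσ.full t d hdR
        _ ≤ _ := Finset.card_le_card (Finset.monotone_filter_right _ fun y _ hy => hy.1)
    -- The college `d` is full in the first run, and by `noblock` its students outside `W` stay with
    -- it in the second. Thus `W` can only have lost seats at `d`.
    have h2 : (Finset.univ.filter fun x => σ.assigned x = some d ∧ x ∉ W).card ≤
        (Finset.univ.filter fun x => τ.assigned x = some d ∧ x ∉ W).card := by
      refine Finset.card_le_card (Finset.monotone_filter_right _ fun x _ hx => ⟨?_, hx.2⟩)
      exact noblock hx.2 (by simp [State.proposed, hx.1]) htd (hσpref hdR hx.1)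
    have hsplit : ∀ ρ : State S C, (Finset.univ.filter fun x => ρ.assigned x = some d).card =
        (W.filter fun x => ρ.assigned x = some d).card +
          (Finset.univ.filter fun x => ρ.assigned x = some d ∧ x ∉ W).card := by
      intro ρ
      rw [← Finset.card_filter_add_card_filter_not (s := Finset.univ.filter
        fun x => ρ.assigned x = some d) (fun x => x ∈ W), Finset.filter_filter,
        Finset.filter_filter]
      congr 2
      ext x
      simp [and_comm]
    rw [hsplit, hsplit] at h1
    omega
  have hsum : ∀ ρ : State S C, ∑ d, (W.filter fun x => ρ.assigned x = some d).card =
      (W.filter fun x => ρ.assigned x ≠ none).card := by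
    intro ρ
    rw [← Finset.card_biUnion]
    · congr 1
      ext x
      simp [Option.ne_none_iff_exists']
    · intro d _ e _ hde
      refine Finset.disjoint_filter.2 fun x _ h1 h2 => hde ?_
      rw [h1] at h2
      exact Option.some.inj h2
  have hτW : (W.filter fun x => τ.assigned x ≠ none) = W :=
    Finset.filter_true_of_mem fun x hx => by
      obtain ⟨d, hd, -⟩ := memW.1 hx
      simp [hd]
  -- All of `W` is matched in `τ`, so the summed inequality must be an equality: `W` is fully
  -- matched in `σ` too, with equally many seats at each college.
  have hle := Finset.sum_le_sum fun d (_ : d ∈ Finset.univ) => hcount d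
  have hσW : (W.filter fun x => σ.assigned x ≠ none) = W := by
    rw [hsum, hsum, hτW] at hle
    exact Finset.eq_of_subset_of_card_le (Finset.filter_subset _ _) hle
  have hcount_eq : ∀ d, (W.filter fun x => τ.assigned x = some d).card =
      (W.filter fun x => σ.assigned x = some d).card := by
    have : ∑ d, (W.filter fun x => τ.assigned x = some d).card =
        ∑ d, (W.filter fun x => σ.assigned x = some d).card := by
      rw [hsum, hsum, hτW, hσW]
    exact fun d => (Finset.sum_eq_sum_iff_of_le fun d _ => hcount d).1 this d (Finset.mem_univ d)
  have hmatched : ∀ t ∈ W, ∃ d, σ.assigned t = some d := fun t ht => by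
    rw [← hσW] at ht
    exact Option.ne_none_iff_exists'.1 (Finset.mem_filter.1 ht).2
  -- the round in which the last student of `W` obtains her final seat
  have hex : ∃ n, n ≤ Fintype.card S * Fintype.card C ∧
      ∀ t ∈ W, (runState next I n).assigned t = σ.assigned t :=
    ⟨_, le_rfl, fun _ _ => rfl⟩
  obtain ⟨hnN, hn⟩ := Nat.find_spec hex
  have hmin := fun {m : ℕ} => Nat.find_min hex (m := m)
  generalize Nat.find hex = n at hnN hn hmin
  cases n with
  | zero =>
    obtain ⟨d, hd⟩ := hmatched s hsW
    have := hn s hsW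
    rw [hd] at this
    simp [runState, State.init] at this
  | succ m =>
    have hm := hmin m.lt_succ_self
    push Not at hm
    obtain ⟨t, htW, ht⟩ := hm (m.le_succ.trans hnN)
    obtain ⟨d, hd⟩ := hmatched t htW
    have hm_valid := runState_valid hnext I m
    have hm1_valid := runState_valid hnext I (m + 1)
    have htd : (runState next I (m + 1)).assigned t = some d := (hn t htW).trans hd
    rw [hd] at ht
    obtain ⟨t₀, ht₀⟩ : (W.filter fun x => τ.assigned x = some d).Nonempty := by
      rw [← Finset.card_pos, hcount_eq]
      exact Finset.card_pos.2 ⟨t, Finset.mem_filter.2 ⟨htW, hd⟩⟩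
    obtain ⟨ht₀W, ht₀d⟩ := Finset.mem_filter.1 ht₀
    -- After round `m + 1` the student `t₀` holds her final seat, so she was not rejected in that
    -- round; the rejection by `d` is older.
    have hdR : d ∈ (runState next I m).rejected t₀ := by
      obtain ⟨e, he, heR⟩ := memW.1 ht₀W
      rw [ht₀d] at he
      cases he
      obtain ⟨b, hb⟩ := hmatched t₀ ht₀W
      have hb' := (hn t₀ ht₀W).trans hb
      rw [hσ.rejected_eq hm1_valid hb hb', runState_succ] at heR
      rw [runState_succ] at hb'
      rwa [State.step_rejected_of_assigned hb'] at heR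
    obtain ⟨y, hyd, hyp, hy⟩ : ∃ y, (runState next I m).assigned y = some d ∧ I.pref d y t₀ ∧
        (runState next I (m + 1)).assigned y ≠ some d := by
      -- Otherwise all the students preferred to `t₀`, at least `cap` many, stay at `d` while `t`
      -- joins, exceeding the capacity.
      by_contra! hcon
      have h1 := hm_valid.full t₀ d hdR
      have h2 := hm1_valid.feasible d
      have h3 : (Finset.univ.filter fun x =>
            (runState next I m).assigned x = some d ∧ I.pref d x t₀).card <
          (Finset.univ.filter fun x => (runState next I (m + 1)).assigned x = some d).card := by
        refine Finset.card_lt_card ((Finset.ssubset_iff_of_subset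
          (Finset.monotone_filter_right _ fun y _ hy => hcon y hy.1 hy.2)).2
            ⟨t, by simpa using htd, by simp [ht]⟩)
      omega
    have hyR : d ∈ σ.rejected y := by
      have := State.mem_step_rejected_of_target (next := next) (I := I)
        (State.target_eq_of_assigned hyd) (by rwa [← runState_succ])
      rw [← runState_succ] at this
      exact runState_rejected_mono next I y hnN this
    -- If `y` were in `W`, she would hold her final seat after round `m + 1`; her only candidacy in
    -- that round is at `d`, which rejects her.
    have hyW : y ∉ W := by
      intro hyW
      obtain ⟨b, hb⟩ := hmatched y hyW
      have hb' := (hn y hyW).trans hb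
      rw [runState_succ] at hb'
      have h1 := (State.step_assigned_eq_some.1 hb').1
      rw [State.target_eq_of_assigned hyd] at h1
      cases h1
      exact hσ.notMem y d hb hyR
    -- `d` prefers `y` to `t₀`, so `noblock` puts `y` at `d` in the second run; having been rejected
    -- by `d` in the first, `y` is in `W` after all.
    exact hyW (memW.2 ⟨d, noblock hyW (by simp [State.proposed, hyR]) ht₀d hyp, hyR⟩)

end StrategyProof

/-! ### Incentive compatibility, deterministic and random -/

section Main

variable {S C F : Type*} [Fintype S] [DecidableEq S] [Fintype C] [DecidableEq C] [Fintype F]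

theorem IsSafe.icc {next : Rule S C F} (h : IsSafe next) : ICC (GDA next) := by
  intro I s r
  have hnext : ∀ s R r, R ≠ Finset.univ → next s R r ∉ R := fun s R r hR => (h s R r hR).1
  cases h' : GDA next (I.misreport s r) s with
  | none => simp [Report.Prefers]
  | some c' =>
    have hc' := notMem_rejected_of_gda hnext (I := I) (J := I.misreport s r) rfl rfl
      (fun x hx => Function.update_of_ne hx _ _) h'
    cases hc : GDA next I s with
    | none =>
      rw [gdaState_final next hnext I s hc] at hc'
      exact absurd (Finset.mem_univ c') hc'
    | some c =>
      have hv := gdaState_valid hnext I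
      rw [hv.eq_next s c hc]
      exact (h s _ _ (hv.ne_univ s c hc)).2 c' hc'

omit [DecidableEq S] in
/-- The algorithm depends only on the values of the rule at the given reports. -/
theorem GDA_congr {next next' : Rule S C F} {I : Instance S C F}
    (h : ∀ s R, next s R (I.report s) = next' s R (I.report s)) : GDA next I = GDA next' I := by
  have htarget : ∀ σ : State S C, σ.target next I = σ.target next' I := fun σ => by
    funext s
    simp only [State.target, h]
  have hstep : State.step next I = State.step next' I := by
    funext σ
    unfold State.step
    rw [htarget]
  simp only [GDA, gdaState, hstep]

theorem exists_measure_fiber_pos {T A : Type*} [MeasurableSpace T] [Finite A] (ν : Measure T)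
    [IsProbabilityMeasure ν] (g : T → A) :
    ∃ a, 0 < ν (g ⁻¹' {a}) := by
  by_contra! h
  have : ν (⋃ a, g ⁻¹' {a}) = 0 := measure_iUnion_null fun a => le_antisymm (h a) bot_le
  rw [← Set.preimage_iUnion, Set.iUnion_of_singleton, Set.preimage_univ, measure_univ] at this
  exact one_ne_zero this

theorem iccRandom_of_icc {T : Type*} [MeasurableSpace T] (ν : Measure T) [IsProbabilityMeasure ν]
    (next : T → Rule S C F) (hmeas : ∀ s R r c, MeasurableSet {t | next t s R r = c})
    (h : ∀ t, ICC (GDA (next t))) : ICCRandom ν fun t => GDA (next t) := by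
  intro I s r h1
  -- `g` records the rule at the two report profiles in play. Its codomain is finite, and on a fibre
  -- both runs agree with those of one fixed rule.
  let g : T → (S → Finset C → C) × (S → Finset C → C) := fun t =>
    (fun x R => next t x R (I.report x), fun x R => next t x R ((I.misreport s r).report x))
  have hg : ∀ a, MeasurableSet (g ⁻¹' {a}) := by
    intro a
    have : g ⁻¹' {a} = ⋂ x, ⋂ R, ({t | next t x R (I.report x) = a.1 x R} ∩
        {t | next t x R ((I.misreport s r).report x) = a.2 x R}) := by
      ext t
      simp only [g, Set.mem_preimage, Set.mem_singleton_iff, Prod.ext_iff, funext_iff,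
        Set.mem_iInter, Set.mem_inter_iff, Set.mem_ofPred_eq, forall_and]
    rw [this]
    exact MeasurableSet.iInter fun x => MeasurableSet.iInter fun R =>
      (hmeas _ _ _ _).inter (hmeas _ _ _ _)
  obtain ⟨a, ha⟩ := exists_measure_fiber_pos ν g
  obtain ⟨t₀, ht₀⟩ := nonempty_of_measure_ne_zero ha.ne'
  set U := g ⁻¹' {a} with hU
  have hI : ∀ t ∈ U, GDA (next t) I = GDA (next t₀) I := fun t ht => GDA_congr fun x R =>
    congrFun (congrFun (congrArg Prod.fst ((show g t = a from ht).trans ht₀.symm)) x) R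
  have hJ : ∀ t ∈ U, GDA (next t) (I.misreport s r) = GDA (next t₀) (I.misreport s r) :=
    fun t ht => GDA_congr fun x R =>
      congrFun (congrFun (congrArg Prod.snd ((show g t = a from ht).trans ht₀.symm)) x) R
  set B := {w | (I.report s).Prefers w (GDA (next t₀) (I.misreport s r) s) (GDA (next t₀) I s)}
    with hB
  have hBmeas : MeasurableSet B := (I.report s).measurableSet_prefers _ _
  have hBc : ((I.report s).μ : Measure (stdSimplex ℝ F)) Bᶜ ≠ 0 := fun h0 =>
    h t₀ I s r ((prob_compl_eq_zero_iff hBmeas).1 h0)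
  have hVmeas : MeasurableSet ((U ×ˢ U) ×ˢ Bᶜ) := ((hg a).prod (hg a)).prod hBmeas.compl
  -- The box has positive measure and misses the event. Passing through its complement avoids having
  -- to show that the event is measurable.
  have hle : ((ν.prod ν).prod ((I.report s).μ : Measure (stdSimplex ℝ F)))
      ((U ×ˢ U) ×ˢ Bᶜ)ᶜ = 1 := by
    refine le_antisymm prob_le_one (h1 ▸ measure_mono ?_)
    rintro ⟨⟨t₁, t₂⟩, w⟩ hp ⟨⟨ht₁, ht₂⟩, hw⟩
    refine hw ?_
    simpa only [hB, Set.mem_ofPred_eq, hI t₁ ht₁, hJ t₂ ht₂] using hp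
  rw [prob_compl_eq_one_iff hVmeas, Measure.prod_prod, Measure.prod_prod] at hle
  simp [ha.ne', hBc] at hle

end Main

end SchoolChoice

theorem mainTheorem4 {S C F T : Type*} [Fintype S] [DecidableEq S] [Fintype C] [DecidableEq C]
    [Fintype F] [MeasurableSpace T] :
    -- predetermined tie-breaking
    (∀ next : SchoolChoice.Rule S C F,
      SchoolChoice.IsLOCV next ∨ SchoolChoice.IsLOICV next ∨
        SchoolChoice.IsHERF next ∨ SchoolChoice.IsHEUF next →
      SchoolChoice.ICC (SchoolChoice.GDA next)) ∧
    -- random tie-breaking, with seed `t` distributed according to `ν`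
    (∀ (ν : MeasureTheory.Measure T) [MeasureTheory.IsProbabilityMeasure ν]
      (next : T → SchoolChoice.Rule S C F),
      (∀ s R r c, MeasurableSet {t | next t s R r = c}) →
      (∀ t, SchoolChoice.IsLOCV (next t)) ∨ (∀ t, SchoolChoice.IsLOICV (next t)) ∨
        (∀ t, SchoolChoice.IsHERF (next t)) ∨ (∀ t, SchoolChoice.IsHEUF (next t)) →
      SchoolChoice.ICCRandom ν (fun t => SchoolChoice.GDA (next t))) := by
  constructor
  · rintro next (h | h | h | h)
    · exact h.isSafe.icc
    · exact h.isSafe.icc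
    · exact h.isSafe.icc
    · exact h.isSafe.icc
  · rintro ν _ next hmeas (h | h | h | h)
    · exact SchoolChoice.iccRandom_of_icc ν next hmeas fun t => (h t).isSafe.icc
    · exact SchoolChoice.iccRandom_of_icc ν next hmeas fun t => (h t).isSafe.icc
    · exact SchoolChoice.iccRandom_of_icc ν next hmeas fun t => (h t).isSafe.icc
    · exact SchoolChoice.iccRandom_of_icc ν next hmeas fun t => (h t).isSafe.icc
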